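/- A permutation of length $n\ge 0$ is a bijection of $\{1,\dots,n\}$ to itself; its length is denoted $|\pi|$. A permutation $\pi$ contains $\sigma$ if some subsequence of $\pi(1)\cdots\pi(n)$ is order isomorphic to $\sigma$, and a permutation class is a set of permutations closed downwards under containment. For a $t\times u$ matrix $M$ with entries in $\{0,1,-1\}$, indexed first by column (left to right) and then by row (bottom to top), the standard figure of $M$ is the union in $\mathbb{R}^2$ of the open line segments from $(k-1,\ell-1)$ to $(k,\ell)$ for all $k,\ell$ with $M_{k,\ell}=1$, and from $(k-1,\ell)$ to $(k,\ell-1)$ for all $k,\ell$ with $M_{k,\ell}=-1$. The geometric grid class $\operatorname{Geom}(M)$ is the set of all permutations obtained by choosing finitely many points of this figure, no two on a common horizontal or vertical line, labelling them $1,\dots,n$ from bottom to top, and reading the labels from left to right. A permutation class is geometrically griddable if it is contained in $\operatorname{Geom}(M)$ for some such matrix $M$. An interval of $\pi$ is a (possibly empty) set of contiguous indices $I$ such that $\pi(I)$ is also contiguous; $\pi$ is simple if its length $n$ is at least $2$ and its only intervals have length $0$, $1$ or $n$. For permutations $\sigma$ of length $m$ and $\tau$ of length $n$, the sum $\sigma\oplus\tau$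 consists of the entries of $\sigma$ followed by the entries of $\tau$ increased by $m$, and the skew sum $\sigma\ominus\tau$ consists of the entries of $\sigma$ increased by $n$ followed by the entries of $\tau$. A permutation is sum indecomposable (resp. skew indecomposable) if it is not the sum (resp. skew sum) of two shorter permutations. Theorem. Let $\mathcal{C}$ be a geometrically griddable class, and let $\mathcal{S}$ be the set of simple permutations in $\mathcal{C}$, or the set of sum indecomposable permutations in $\mathcal{C}$, or the set of skew indecomposable permutations in $\mathcal{C}$. Then, in each of the three cases, there are a finite alphabet $\Sigma$, a regular language $L\subseteq\Sigma^\ast$ and a bijection $\varphi: L\to\mathcal{S}$ with $|\varphi(w)|=|w|$ for all $w\in L$; and the generating function $\sum_{\pi\in\mathcal{S}}x^{|\pi|}$ is rational, i.e. it is the power series expansion of $p(x)/q(x)$ for some polynomials $p,q\in\mathbb{Q}[x]$ with $q(0)\ne 0$. -/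

import Mathlib

namespace GeomGrid

/-- A permutation of arbitrary finite length `n` (possibly `n = 0`). -/
abbrev Permutation : Type := Σ n : ℕ, Equiv.Perm (Fin n)

/-- The length of a permutation. -/
abbrev Permutation.length (π : Permutation) : ℕ := π.1

/-- Pattern containment `σ ≤ π`: some subsequence of `π` is order isomorphic to `σ`. -/
def Involves (σ π : Permutation) : Prop :=
  ∃ f : Fin σ.1 → Fin π.1, StrictMono f ∧ ∀ i j, σ.2 i < σ.2 j ↔ π.2 (f i) < π.2 (f j)

/-- A permutation class is a set of permutations closed downwards under containment. -/
def IsPermutationClass (C : Set Permutation) : Prop :=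
  ∀ π ∈ C, ∀ σ, Involves σ π → σ ∈ C

/-- The standard figure of a `0/±1` matrix. Matrices are indexed first by column (left to right),
then by row (bottom to top); with indices starting at `0`, the cell `(k, l)` is the square with
corners `(k, l)` and `(k + 1, l + 1)`. -/
def standardFigure {t u : ℕ} (M : Matrix (Fin t) (Fin u) SignType) : Set (ℝ × ℝ) :=
  {p | ∃ (k : Fin t) (l : Fin u),
    (M k l = 1 ∧ p ∈ openSegment ℝ ((k : ℝ), (l : ℝ)) ((k : ℝ) + 1, (l : ℝ) + 1)) ∨
    (M k l = -1 ∧ p ∈ openSegment ℝ ((k : ℝ), (l : ℝ) + 1) ((k : ℝ) + 1, (l : ℝ)))}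

/-- The permutations that can be drawn on the figure `F`: choose `n` points of `F`, no two on a
common horizontal or vertical line, list them from left to right as `p 0, …, p (n - 1)`, and
record their relative heights. -/
def Sub (F : Set (ℝ × ℝ)) : Set Permutation :=
  {π | ∃ p : Fin π.1 → ℝ × ℝ, (∀ i, p i ∈ F) ∧ StrictMono (fun i => (p i).1) ∧
    ∀ i j, π.2 i < π.2 j ↔ (p i).2 < (p j).2}

/-- The geometric grid class of a `0/±1` matrix. -/
def Geom {t u : ℕ} (M : Matrix (Fin t) (Fin u) SignType) : Set Permutation :=
  Sub (standardFigure M)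

/-- A geometrically griddable class is a permutation class contained in some geometric grid
class. -/
def IsGeometricallyGriddable (C : Set Permutation) : Prop :=
  IsPermutationClass C ∧ ∃ (t u : ℕ) (M : Matrix (Fin t) (Fin u) SignType), C ⊆ Geom M

/-- An interval of `π`: a contiguous set of indices whose set of values is contiguous. -/
def IsInterval {n : ℕ} (π : Equiv.Perm (Fin n)) (I : Set (Fin n)) : Prop :=
  I.OrdConnected ∧ (π '' I).OrdConnected

/-- A permutation of length at least `2` is simple if its only intervals are those of length
`0`, `1` and `n`. -/
def IsSimple (π : Permutation) : Prop :=
  2 ≤ π.length ∧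
    ∀ I : Set (Fin π.1), IsInterval π.2 I → I.ncard = 0 ∨ I.ncard = 1 ∨ I.ncard = π.length

/-- The sum `σ ⊕ τ`: the entries of `σ`, followed by the entries of `τ` increased by `|σ|`. -/
def directSum (σ τ : Permutation) : Permutation :=
  ⟨σ.1 + τ.1, finSumFinEquiv.symm.trans ((Equiv.sumCongr σ.2 τ.2).trans finSumFinEquiv)⟩

/-- The skew sum `σ ⊖ τ`: the entries of `σ` increased by `|τ|`, followed by the entries
of `τ`. -/
def skewSum (σ τ : Permutation) : Permutation :=
  ⟨σ.1 + τ.1, finSumFinEquiv.symm.trans ((Equiv.sumCongr σ.2 τ.2).trans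
    ((Equiv.sumComm (Fin σ.1) (Fin τ.1)).trans
      (finSumFinEquiv.trans (finCongr (Nat.add_comm τ.1 σ.1)))))⟩

/-- Not the sum of two shorter permutations. -/
def IsSumIndecomposable (π : Permutation) : Prop :=
  ¬ ∃ σ τ : Permutation, σ.length < π.length ∧ τ.length < π.length ∧ π = directSum σ τ

/-- Not the skew sum of two shorter permutations. -/
def IsSkewIndecomposable (π : Permutation) : Prop :=
  ¬ ∃ σ τ : Permutation, σ.length < π.length ∧ τ.length < π.length ∧ π = skewSum σ τ

/-- The set `S` of permutations is in (length-preserving) bijection with a regular language over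
a finite alphabet. -/
def InBijectionWithRegularLanguage (S : Set Permutation) : Prop :=
  ∃ (α : Type) (_ : Fintype α) (L : Language α), L.IsRegular ∧
    ∃ φ : List α → Permutation, Set.BijOn φ {w | w ∈ L} S ∧ ∀ w ∈ L, (φ w).length = w.length

/-- The generating function `∑ x ^ |π|`, the sum being over all `π ∈ S`. -/
noncomputable def generatingFunction (S : Set Permutation) : PowerSeries ℚ :=
  PowerSeries.mk fun n =>
    (({π : Equiv.Perm (Fin n) | (⟨n, π⟩ : Permutation) ∈ S}.ncard : ℕ) : ℚ)

/-- The power series `F` is the expansion at `0` of a quotient `p / q` of polynomials. -/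
def IsRationalSeries (F : PowerSeries ℚ) : Prop :=
  ∃ p q : Polynomial ℚ, q.coeff 0 ≠ 0 ∧ (q : PowerSeries ℚ) * F = (p : PowerSeries ℚ)

end GeomGrid

/-!
A word over a finite alphabet of cells, each lying in one column and one row, draws a permutation:
its letters insert one point after the other into their cells, and within each column (row) the
new point is placed beyond all earlier ones, on the left or on the right (above or below) as
prescribed for that column (row). Cutting every cell of a matrix at its centre, and inserting the
points of a drawing in order of their distance from the centres, shows that all members of a
geometric grid class are drawn in this way (`exists_permOf_eq_of_mem_geom`).

Regularity rests on a single principle. By Higman's lemma every subword-closed language is regular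
(`isRegular_of_sublist_closed`), and deleting letters of a word deletes entries of the permutation
that it draws. So the words with marked letters for which the marked permutation has a given
hereditary property form a regular language (`Recognizable.of_isHereditary`), and Boolean
combinations and existential quantification over the marks preserve regularity. The following
properties of the word, or of the permutation it draws, are obtained in this way.

* Membership in the class is itself hereditary.
* A permutation is a sum, a skew sum, or has a nontrivial interval, if its entries can be marked by
  two colours so that every pair or triple of entries satisfies a universal condition, and some
  entries of prescribed colours exist.
* Only one gridding of each permutation should be used, the lexicographically least. That a word
  gives a different one is witnessed by marks: the cells of another gridding (being a gridding is
  hereditary) and the first place where it is smaller (`regularPred_isPreferred`).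
* Two words give the same gridded permutation exactly if they differ by commutations of letters
  that share neither a column nor a row. The lexicographically least word of each such class is
  characterized by a forbidden pattern, which again is a hereditary condition on marks
  (`regularPred_isNormal`).

So each permutation of the class has exactly one word in a regular language
(`inBijectionWithRegularLanguage_of_recognizable`), and its length is that of the permutation. The
generating function of a regular language is rational since the series that count the words
accepted from the various states of an automaton solve a linear system with the matrix `1 - x A`.
-/
namespace GeomGrid

/-! ### Regular languages -/

theorem wellQuasiOrdered_sublist (α : Type*) [Finite α] :
    WellQuasiOrdered (List.Sublist : List α → List α → Prop) := by
  have h := Set.PartiallyWellOrderedOn.partiallyWellOrderedOn_sublistForall₂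
    (Eq : α → α → Prop) (s := Set.univ) (Set.toFinite _).partiallyWellOrderedOn
  intro w
  obtain ⟨m, n, hmn, hs⟩ := h fun k => ⟨w k, fun _ _ => Set.mem_univ _⟩
  refine ⟨m, n, hmn, ?_⟩
  obtain ⟨l, hl, hl'⟩ := List.sublistForall₂_iff.1 hs
  rw [List.forall₂_eq_eq_eq] at hl
  change w m = l at hl
  exact hl ▸ hl'

/-- A consequence of Higman's lemma. The left quotients of `L` decrease as the prefix grows in the
subword order, and there is no infinite descending chain of subword-closed languages, so there are
only finitely many left quotients. -/
theorem isRegular_of_sublist_closed {α : Type*} [Finite α] {L : Language α}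
    (h : ∀ v w : List α, v.Sublist w → w ∈ L → v ∈ L) : L.IsRegular := by
  rw [Language.isRegular_iff_finite_range_leftQuotient]
  by_contra hinf
  have := (Set.not_finite.1 hinf).to_subtype
  have e := Infinite.natEmbedding (Set.range L.leftQuotient)
  choose w hw using fun k => (e k).2
  have : IsPreorder (List α) List.Sublist :=
    { refl := List.Sublist.refl, trans := fun _ _ _ => List.Sublist.trans }
  obtain ⟨g, hg⟩ := (wellQuasiOrdered_sublist α).exists_monotone_subseq w
  have hsub : ∀ m n, m ≤ n → ∀ x, x ∈ L.leftQuotient (w (g n)) → x ∈ L.leftQuotient (w (g m)) :=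
    fun m n hmn x hx => h _ _ ((hg m n hmn).append_right x) hx
  have hne : ∀ m, ∃ x, x ∈ L.leftQuotient (w (g m)) ∧ x ∉ L.leftQuotient (w (g (m + 1))) := by
    intro m
    by_contra! hc
    have heq : L.leftQuotient (w (g m)) = L.leftQuotient (w (g (m + 1))) :=
      Set.Subset.antisymm hc (hsub _ _ (Nat.le_succ m))
    rw [hw, hw] at heq
    have := g.injective (e.injective (Subtype.ext heq))
    omega
  choose x hx hx' using hne
  obtain ⟨m, n, hmn, hs⟩ := wellQuasiOrdered_sublist α x
  refine hx' m (h _ _ ((List.Sublist.refl _).append hs) ?_)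
  exact hsub (m + 1) n hmn _ (hx n)

theorem _root_.Language.IsRegular.map {α β : Type*} {L : Language α} (h : L.IsRegular)
    (p : α → β) : (Language.map p L).IsRegular := by
  rw [Language.isRegular_iff_finite_range_leftQuotient] at h ⊢
  refine (h.finite_subsets.image
    fun T : Set (Language α) => (sSup (Language.map p '' T) : Language β)).subset ?_
  rintro _ ⟨w, rfl⟩
  refine ⟨{Q | ∃ z : List α, z.map p = w ∧ L.leftQuotient z = Q}, ?_, ?_⟩
  · rintro _ ⟨z, -, rfl⟩
    exact ⟨z, rfl⟩
  · ext y
    constructor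
    · rintro ⟨_, ⟨_, ⟨z, hz, rfl⟩, rfl⟩, u, hu, rfl⟩
      exact ⟨z ++ u, hu, by simp [hz]⟩
    · rintro ⟨z, hz, hzy⟩
      obtain ⟨z₁, z₂, rfl, h₁, h₂⟩ := List.map_eq_append_iff.1 hzy
      exact ⟨_, ⟨_, ⟨z₁, h₁, rfl⟩, rfl⟩, z₂, hz, h₂⟩

/-- A predicate on words, given as functions on `Fin n`, is regular if the language of the words
that satisfy it is. -/
def RegularPred {A : Type*} (P : ∀ n, (Fin n → A) → Prop) : Prop :=
  Language.IsRegular ({w | P w.length w.get} : Language A)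

namespace RegularPred

variable {A D : Type*} {P Q : ∀ n, (Fin n → A) → Prop}

theorem congr (h : RegularPred P) (hPQ : ∀ n f, P n f ↔ Q n f) : RegularPred Q := by
  have : P = Q := by
    funext n f
    exact propext (hPQ n f)
  exact this ▸ h

theorem and (hP : RegularPred P) (hQ : RegularPred Q) : RegularPred fun n f => P n f ∧ Q n f :=
  Language.IsRegular.inf hP hQ

theorem not (hP : RegularPred P) : RegularPred fun n f => ¬ P n f :=
  Language.IsRegular.compl hP

/-- Predicates inherited by subwords are regular. -/
theorem of_hereditary [Finite A]
    (h : ∀ m n (u : Fin m → Fin n) (f : Fin n → A), StrictMono u → P n f → P m (f ∘ u)) :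
    RegularPred P := by
  refine isRegular_of_sublist_closed fun v w hvw hw => ?_
  obtain ⟨u, hu⟩ := List.sublist_iff_exists_fin_orderEmbedding_get_eq.1 hvw
  have := h _ _ u w.get u.strictMono hw
  rwa [show w.get ∘ u = v.get from funext fun i => (hu i).symm] at this

/-- Regular predicates are closed under existential quantification over a marking of the
letters. -/
theorem exists_marks {R : ∀ n, (Fin n → A × D) → Prop} (h : RegularPred R) :
    RegularPred fun n (f : Fin n → A) => ∃ m : Fin n → D, R n fun i => (f i, m i) := by
  refine (congr_arg Language.IsRegular ?_).mp (Language.IsRegular.map h Prod.fst)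
  ext w
  constructor
  · rintro ⟨z, hz, rfl⟩
    refine ⟨fun i => (z.get (i.cast (by simp))).2, ?_⟩
    have hz : R z.length z.get := hz
    have key : ∀ n (hn : n = z.length), R n fun i => z.get (i.cast hn) := by
      rintro n rfl
      exact hz
    convert key (z.map Prod.fst).length (by simp) using 2
    ext <;> simp
  · rintro ⟨m, hm⟩
    refine ⟨List.ofFn fun i => (w.get i, m i), ?_, ?_⟩
    · change R _ _
      have key : ∀ n (hn : n = w.length), R n fun i => (w.get (i.cast hn), m (i.cast hn)) := by
        rintro n rfl
        exact hm
      convert key (List.ofFn fun i => (w.get i, m i)).length (by simp) using 2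
      simp
      rfl
    · rw [List.map_ofFn]
      exact List.ofFn_get w

theorem exists_letter [Finite A] (p : A → Prop) :
    RegularPred fun n (f : Fin n → A) => ∃ i, p (f i) := by
  refine (RegularPred.not (P := fun n f => ∀ i, ¬ p (f i)) (of_hereditary ?_)).congr
    fun n f => by simp
  exact fun m n u f _ h i => h (u i)

end RegularPred

/-! ### Rational generating functions -/

open PowerSeries in
/-- A vector of power series with `F = v + x A F` consists of rational series: multiply
`(1 - x A) F = v` by the adjugate of `1 - x A`. -/
theorem isRationalSeries_of_linear_system {σ : Type*} [Fintype σ] [DecidableEq σ]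
    (A : Matrix σ σ ℚ) (v : σ → ℚ) (F : σ → PowerSeries ℚ)
    (hF : ∀ s, F s = C (v s) + X * ∑ t, C (A s t) * F t) (s : σ) :
    IsRationalSeries (F s) := by
  classical
  let B : Matrix σ σ (Polynomial ℚ) := 1 - (Polynomial.X : Polynomial ℚ) • A.map Polynomial.C
  let ι : Polynomial ℚ →+* PowerSeries ℚ := Polynomial.coeToPowerSeries.ringHom
  have hB : (B.map ι).mulVec F = fun s => C (v s) := by
    ext1 s
    have hX : ι Polynomial.X = X := by simp [ι]
    have hC : ∀ a, ι (Polynomial.C a) = C a := by simp [ι]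
    have h1 : B.map ι = 1 - (X : PowerSeries ℚ) • A.map C := by
      ext1 i j
      simp only [B, Matrix.map_apply, Matrix.sub_apply, Matrix.smul_apply, smul_eq_mul, map_sub,
        map_mul, hX, hC]
      congr 1
      by_cases hij : i = j <;> simp [hij, Matrix.one_apply]
    rw [h1, Matrix.sub_mulVec, Matrix.one_mulVec, Matrix.smul_mulVec, Pi.sub_apply, Pi.smul_apply,
      hF s]
    simp [Matrix.mulVec, dotProduct]
  refine ⟨∑ t, B.adjugate s t * Polynomial.C (v t), B.det, ?_, ?_⟩
  · have := Matrix.eval_charpolyRev (M := A)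
    rw [← Polynomial.coeff_zero_eq_eval_zero] at this
    change A.charpolyRev.coeff 0 ≠ 0
    rw [this]
    exact one_ne_zero
  · have h1 : ((B.map ι).adjugate * B.map ι).mulVec F = (B.map ι).det • F := by
      rw [Matrix.adjugate_mul, Matrix.smul_mulVec, Matrix.one_mulVec]
    rw [← Matrix.mulVec_mulVec, hB] at h1
    have h2 := congr_fun h1 s
    have hdet : (B.map ι).det = ι B.det := (RingHom.map_det ι B).symm
    have hadj : (B.map ι).adjugate = B.adjugate.map ι := (RingHom.map_adjugate ι B).symm
    rw [hdet, hadj] at h2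
    have hsum : ((∑ t, B.adjugate s t * Polynomial.C (v t) : Polynomial ℚ) : PowerSeries ℚ) =
        ∑ t, ι (B.adjugate s t) * C (v t) := by
      rw [← Polynomial.coeToPowerSeries.ringHom_apply, map_sum]
      simp [ι]
    rw [hsum]
    change ι B.det * F s = _
    simp only [Pi.smul_apply, smul_eq_mul] at h2
    rw [← h2]
    simp [Matrix.mulVec, dotProduct]

/-- The number of words of length `n` that lead from the state `s` to an accepting state. -/
noncomputable def acceptedCount {α σ : Type*} (M : DFA α σ) (n : ℕ) (s : σ) : ℕ :=
  Nat.card {f : Fin n → α // M.evalFrom s (List.ofFn f) ∈ M.accept}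

theorem acceptedCount_succ {α σ : Type*} [Fintype α] (M : DFA α σ) (n : ℕ) (s : σ) :
    acceptedCount M (n + 1) s = ∑ a, acceptedCount M n (M.step s a) := by
  classical
  unfold acceptedCount
  rw [← Nat.card_sigma]
  refine Nat.card_congr
    { toFun := fun f => ⟨f.1 0, fun i => f.1 i.succ, by
        have := f.2
        rwa [List.ofFn_succ, DFA.evalFrom_cons] at this⟩
      invFun := fun f => ⟨Fin.cons f.1 f.2.1, by
        rw [List.ofFn_succ, DFA.evalFrom_cons]
        simpa using f.2.2⟩
      left_inv := fun f => Subtype.ext (Fin.cons_self_tail f.1)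
      right_inv := fun f => rfl }

theorem isRationalSeries_acceptedCount {α σ : Type*} [Fintype α] [Fintype σ] (M : DFA α σ)
    (s : σ) : IsRationalSeries (PowerSeries.mk fun n => (acceptedCount M n s : ℚ)) := by
  classical
  refine isRationalSeries_of_linear_system
    (Matrix.of fun s t => ∑ a, if M.step s a = t then (1 : ℚ) else 0)
    (fun s => acceptedCount M 0 s) (fun s => PowerSeries.mk fun n => (acceptedCount M n s : ℚ))
    (fun s => ?_) s
  ext n
  rcases n with _ | n
  · simp
  · rw [map_add, PowerSeries.coeff_succ_X_mul]
    simp only [PowerSeries.coeff_mk, acceptedCount_succ, PowerSeries.coeff_C, map_sum,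
      Matrix.of_apply, Nat.cast_sum, Finset.sum_mul]
    rw [Finset.sum_comm]
    refine (zero_add _).symm.trans (congr_arg₂ _ (by simp) (Finset.sum_congr rfl fun a _ => ?_))
    rw [Finset.sum_eq_single (M.step s a) (fun t _ ht => by simp [Ne.symm ht]) (by simp)]
    simp

theorem InBijectionWithRegularLanguage.isRationalSeries {S : Set Permutation}
    (h : InBijectionWithRegularLanguage S) : IsRationalSeries (generatingFunction S) := by
  obtain ⟨α, _, L, ⟨σ, _, M, rfl⟩, φ, hφ, hlen⟩ := h
  convert isRationalSeries_acceptedCount M M.start using 1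
  ext n
  simp only [generatingFunction, PowerSeries.coeff_mk, Nat.cast_inj]
  have h1 : (Sigma.mk n : _ → Permutation) ''
      {π : Equiv.Perm (Fin n) | (⟨n, π⟩ : Permutation) ∈ S} =
      φ '' {w | w ∈ M.accepts ∧ w.length = n} := by
    ext π
    constructor
    · rintro ⟨π, hπ, rfl⟩
      obtain ⟨w, hw, hwπ⟩ := hφ.surjOn hπ
      exact ⟨w, ⟨hw, by rw [← hlen w hw, hwπ]⟩, hwπ⟩
    · rintro ⟨w, ⟨hw, rfl⟩, rfl⟩
      have hl : (φ w).1 = w.length := hlen w hw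
      rw [← hl]
      exact ⟨(φ w).2, hφ.mapsTo hw, rfl⟩
  have h2 : {w | w ∈ M.accepts ∧ w.length = n} =
      List.ofFn '' {f : Fin n → α | M.evalFrom M.start (List.ofFn f) ∈ M.accept} := by
    ext w
    constructor
    · rintro ⟨hw, rfl⟩
      exact ⟨w.get, by rw [Set.mem_ofPred_eq, List.ofFn_get]; exact hw, List.ofFn_get w⟩
    · rintro ⟨f, hf, rfl⟩
      exact ⟨hf, by simp⟩
  rw [← Set.ncard_image_of_injective _ (sigma_mk_injective : Function.Injective
    (Sigma.mk n : _ → Permutation)), h1,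
    (hφ.injOn.mono fun w hw => hw.1).ncard_image, h2,
    Set.ncard_image_of_injective _ List.ofFn_injective]
  rfl

section Words

/-! ### Words as drawings of permutations -/

variable {A ι κ : Type*}

/-- The position along one axis of a point that lies in the slab `h (g i)` of that axis (a column
or a row) and was inserted at time `τ i`. Slabs are ordered by their number; within an odd slab
the positions increase with time, within an even slab they decrease. -/
noncomputable def key (h : A → ℕ) (g : ι → A) (τ : ι → ℝ) (i : ι) : ℕ ×ₗ ℝ :=
  toLex (h (g i), if Even (h (g i)) then -τ i else τ i)

theorem key_lt_key {h : A → ℕ} {g : ι → A} {τ : ι → ℝ} {i j : ι} :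
    key h g τ i < key h g τ j ↔ h (g i) < h (g j) ∨
      h (g i) = h (g j) ∧ if Even (h (g i)) then τ j < τ i else τ i < τ j := by
  unfold key
  rw [Prod.Lex.toLex_lt_toLex]
  refine or_congr Iff.rfl (and_congr_right fun hij => ?_)
  simp only at hij
  simp only [hij]
  split_ifs <;> simp

theorem key_comp (h : A → ℕ) (g : ι → A) (τ : ι → ℝ) (u : κ → ι) (i : κ) :
    key h (g ∘ u) (τ ∘ u) i = key h g τ (u i) := rfl

theorem key_injective (h : A → ℕ) (g : ι → A) {τ : ι → ℝ} (hτ : Function.Injective τ) :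
    Function.Injective (key h g τ) := by
  intro i j hij
  unfold key at hij
  have h1 := congr_arg (fun x => (ofLex x).1) hij
  have h2 := congr_arg (fun x => (ofLex x).2) hij
  simp only [ofLex_toLex] at h1 h2
  rw [h1] at h2
  refine hτ ?_
  split_ifs at h2
  · exact neg_injective h2
  · exact h2

/-- The times at which the letters of a word of length `n` are inserted. -/
def time {n : ℕ} (i : Fin n) : ℝ := (i : ℕ)

theorem time_lt_time {n : ℕ} {i j : Fin n} : time i < time j ↔ i < j := by
  simp [time]

theorem time_injective {n : ℕ} : Function.Injective (time : Fin n → ℝ) := by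
  intro i j h
  simpa [time, Fin.ext_iff] using h

theorem key_time_comp_lt {m n : ℕ} (h : A → ℕ) (f : Fin n → A) {u : Fin m → Fin n}
    (hu : StrictMono u) {i j : Fin m} :
    key h (f ∘ u) time i < key h (f ∘ u) time j ↔
      key h f time (u i) < key h f time (u j) := by
  simp only [key_lt_key, Function.comp_apply, time_lt_time, hu.lt_iff_lt]

theorem sort_lt_iff {n : ℕ} {α : Type*} [LinearOrder α] {k : Fin n → α}
    (hk : Function.Injective k) {i j : Fin n} :
    k (Tuple.sort k i) < k (Tuple.sort k j) ↔ i < j :=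
  ((Tuple.monotone_sort k).strictMono_of_injective
    (hk.comp (Tuple.sort k).injective)).lt_iff_lt

variable (c r : A → ℕ)

/-- The letters of the word `f`, listed by the horizontal position of the point they insert. -/
noncomputable def leftToRight {n : ℕ} (f : Fin n → A) : Equiv.Perm (Fin n) :=
  Tuple.sort (key c f time)

/-- The permutation drawn by a word: its letter `a` inserts a point in column `c a` and row
`r a`. -/
noncomputable def permOf {n : ℕ} (f : Fin n → A) : Equiv.Perm (Fin n) :=
  (leftToRight c f).trans (Tuple.sort (key r f time)).symm

theorem leftToRight_lt_iff {n : ℕ} (f : Fin n → A) {i j : Fin n} :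
    key c f time (leftToRight c f i) < key c f time (leftToRight c f j) ↔ i < j :=
  sort_lt_iff (key_injective c f time_injective)

theorem permOf_lt_iff {n : ℕ} (f : Fin n → A) {i j : Fin n} :
    permOf c r f i < permOf c r f j ↔
      key r f time (leftToRight c f i) < key r f time (leftToRight c f j) := by
  rw [← sort_lt_iff (key_injective r f time_injective)]
  simp [permOf]

/-- The permutation `σ` is drawn by points which, from left to right, lie in the cells
`g 0, g 1, …` and were inserted at times `τ 0, τ 1, …`. -/
structure Draws {n : ℕ} (σ : Equiv.Perm (Fin n)) (g : Fin n → A) (τ : Fin n → ℝ) : Prop where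
  x : ∀ i j, i < j ↔ key c g τ i < key c g τ j
  y : ∀ i j, σ i < σ j ↔ key r g τ i < key r g τ j

/-- The cells `g 0, g 1, …`, from left to right, come from some drawing of `σ`. -/
def IsGridding {n : ℕ} (σ : Equiv.Perm (Fin n)) (g : Fin n → A) : Prop :=
  ∃ τ, Draws c r σ g τ

variable {c r} {n : ℕ}

theorem perm_ext_of_lt_iff {σ τ : Equiv.Perm (Fin n)} (h : ∀ i j, σ i < σ j ↔ τ i < τ j) :
    σ = τ := by
  have hm : StrictMono (σ.symm.trans τ) := by
    intro i j hij
    simpa using (h (σ.symm i) (σ.symm j)).1 (by simpa using hij)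
  have h1 : (σ.symm.trans τ : Fin n → Fin n) = id :=
    (Equiv.Perm.monotone_iff _).1 hm.monotone ▸ rfl
  ext i
  simpa using (congr_arg Fin.val (congr_fun h1 (σ i))).symm

theorem draws_permOf (f : Fin n → A) :
    Draws c r (permOf c r f) (f ∘ leftToRight c f) (time ∘ leftToRight c f) where
  x _ _ := (leftToRight_lt_iff c f).symm
  y _ _ := permOf_lt_iff c r f

theorem Draws.leftToRight_eq {σ : Equiv.Perm (Fin n)} {f : Fin n → A} {e : Equiv.Perm (Fin n)}
    (h : Draws c r σ (f ∘ e) (time ∘ e)) : leftToRight c f = e := by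
  have h1 : (leftToRight c f).symm = e.symm := by
    refine perm_ext_of_lt_iff fun i j => ?_
    rw [← leftToRight_lt_iff c f, h.x]
    simp [key_comp]
  rw [← Equiv.symm_symm (leftToRight c f), h1, Equiv.symm_symm]

theorem Draws.permOf_eq {σ : Equiv.Perm (Fin n)} {f : Fin n → A} {e : Equiv.Perm (Fin n)}
    (h : Draws c r σ (f ∘ e) (time ∘ e)) : permOf c r f = σ := by
  refine perm_ext_of_lt_iff fun i j => ?_
  rw [permOf_lt_iff, h.y, h.leftToRight_eq]
  rfl

/-- Letters whose cells share neither a column nor a row. -/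
def Indep (c r : A → ℕ) (a b : A) : Prop := c a ≠ c b ∧ r a ≠ r b

theorem Indep.symm {a b : A} (h : Indep c r a b) : Indep c r b a := ⟨h.1.symm, h.2.symm⟩

theorem not_indep_self (a : A) : ¬ Indep c r a a := fun h => h.1 rfl

theorem key_lt_congr {h : A → ℕ} {g : ι → A} {τ τ' : ι → ℝ} {i j : ι}
    (h1 : h (g i) = h (g j) → (τ i < τ j ↔ τ' i < τ' j))
    (h2 : h (g i) = h (g j) → (τ j < τ i ↔ τ' j < τ' i)) :
    key h g τ i < key h g τ j ↔ key h g τ' i < key h g τ' j := by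
  simp only [key_lt_key]
  refine or_congr Iff.rfl (and_congr_right fun hij => ?_)
  rw [h1 hij, h2 hij]

/-- Only the relative times of points that share a column or a row matter. -/
theorem Draws.of_lt_iff {σ : Equiv.Perm (Fin n)} {g : Fin n → A} {τ τ' : Fin n → ℝ}
    (h : Draws c r σ g τ)
    (hτ : ∀ i j, ¬ Indep c r (g i) (g j) → (τ i < τ j ↔ τ' i < τ' j)) : Draws c r σ g τ' where
  x i j := (h.x i j).trans (key_lt_congr (fun e => hτ i j fun hi => hi.1 e)
    fun e => hτ j i fun hi => hi.1 e.symm)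
  y i j := (h.y i j).trans (key_lt_congr (fun e => hτ i j fun hi => hi.2 e)
    fun e => hτ j i fun hi => hi.2 e.symm)

theorem lt_of_key_lt_iff {h : A → ℕ} {g : ι → A} {τ τ' : ι → ℝ}
    (hk : ∀ i j, key h g τ i < key h g τ j ↔ key h g τ' i < key h g τ' j) {i j : ι}
    (hij : h (g i) = h (g j)) : τ i < τ j ↔ τ' i < τ' j := by
  have h1 := hk i j
  have h2 := hk j i
  simp only [key_lt_key, hij, lt_irrefl, false_or, true_and] at h1 h2
  split_ifs at h1 h2
  · exact h2
  · exact h1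

theorem Draws.lt_iff {σ : Equiv.Perm (Fin n)} {g : Fin n → A} {τ τ' : Fin n → ℝ}
    (h : Draws c r σ g τ) (h' : Draws c r σ g τ') {i j : Fin n}
    (hij : ¬ Indep c r (g i) (g j)) : τ i < τ j ↔ τ' i < τ' j := by
  by_cases hc : c (g i) = c (g j)
  · exact lt_of_key_lt_iff (fun i j => (h.x i j).symm.trans (h'.x i j)) hc
  · have hr : r (g i) = r (g j) := by_contra fun hr => hij ⟨hc, hr⟩
    exact lt_of_key_lt_iff (fun i j => (h.y i j).symm.trans (h'.y i j)) hr

theorem Draws.time_ne {σ : Equiv.Perm (Fin n)} {g : Fin n → A} {τ : Fin n → ℝ}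
    (h : Draws c r σ g τ) {i j : Fin n} (hij : ¬ Indep c r (g i) (g j)) (hne : i ≠ j) :
    τ i ≠ τ j := by
  intro he
  by_cases hc : c (g i) = c (g j)
  · have h1 := h.x i j
    have h2 := h.x j i
    simp only [key_lt_key, hc, he, lt_irrefl, ite_self, and_false, or_false, iff_false] at h1 h2
    omega
  · have hr : r (g i) = r (g j) := by_contra fun hr => hij ⟨hc, hr⟩
    have h1 := h.y i j
    have h2 := h.y j i
    simp only [key_lt_key, hr, he, lt_irrefl, ite_self, and_false, or_false, iff_false] at h1 h2
    exact hne (σ.injective (le_antisymm (not_lt.1 h2) (not_lt.1 h1)))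

/-- Any times can be replaced by `0, 1, …, n - 1`, so every gridding comes from a word. -/
theorem IsGridding.exists_draws_time {σ : Equiv.Perm (Fin n)} {g : Fin n → A}
    (h : IsGridding c r σ g) : ∃ e : Equiv.Perm (Fin n), Draws c r σ g (time ∘ e) := by
  obtain ⟨τ, h⟩ := h
  refine ⟨(Tuple.sort τ).symm, h.of_lt_iff fun i j hij => ?_⟩
  rw [Function.comp_apply, Function.comp_apply, time_lt_time]
  have hle : ∀ i j, (Tuple.sort τ).symm i ≤ (Tuple.sort τ).symm j → τ i ≤ τ j := by
    intro i j hij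
    simpa using Tuple.monotone_sort τ hij
  constructor
  · intro hlt
    by_contra hc
    exact absurd (hle _ _ (not_lt.1 hc)) (not_le.2 hlt)
  · intro hlt
    refine lt_of_le_of_ne (hle _ _ hlt.le) (h.time_ne hij ?_)
    rintro rfl
    exact lt_irrefl _ hlt

theorem exists_permOf_eq_of_isGridding {σ : Equiv.Perm (Fin n)} {g : Fin n → A}
    (h : IsGridding c r σ g) : ∃ f : Fin n → A, permOf c r f = σ := by
  obtain ⟨e, he⟩ := h.exists_draws_time
  refine ⟨g ∘ e.symm, Draws.permOf_eq (e := e) ?_⟩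
  rwa [Function.comp_assoc, Equiv.symm_comp_self, Function.comp_id]

/-! ### Normal forms of words with the same gridding -/

section NormalForm

variable [LinearOrder A]

/-- No letter can be moved to the left past letters independent of it, so as to replace a larger
letter. This describes the lexicographically least word of a trace, i.e. of a class of words up
to commutation of independent letters. -/
def IsNormal (c r : A → ℕ) (f : Fin n → A) : Prop :=
  ∀ p q, p < q → f q < f p → ¬ ∀ s, p ≤ s → s < q → Indep c r (f s) (f q)

/-- Two normal words with a letter-preserving bijection `ρ` of their positions that keeps the order
of dependent letters are equal. At the first difference `p`, the letter which the other word has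
there can be moved to `p` in either word, and in one of the words it would replace a larger one. -/
theorem eq_one_of_isNormal {f f' : Fin n → A} (hf : IsNormal c r f) (hf' : IsNormal c r f')
    (ρ : Equiv.Perm (Fin n)) (hρ : ∀ p, f' (ρ p) = f p)
    (hd : ∀ p q, ¬ Indep c r (f p) (f q) → (p < q ↔ ρ p < ρ q)) : ρ = 1 := by
  by_contra hne
  have hex : ∃ p, ρ p ≠ p := by
    by_contra! hc
    exact hne (Equiv.ext hc)
  obtain ⟨p, hp, hmin⟩ := WellFounded.has_min (wellFounded_lt (α := Fin n)) {p | ρ p ≠ p} hex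
  have hfix : ∀ s, s < p → ρ s = s := fun s hs => by_contra fun hc => hmin s hc hs
  have hge : ∀ s, p ≤ s → p ≤ ρ s := by
    intro s hs
    by_contra hc
    exact hc (hs.trans_eq (ρ.injective (hfix _ (not_le.1 hc))).symm)
  have hge' : ∀ s, p ≤ s → p ≤ ρ.symm s := by
    intro s hs
    by_contra hc
    have := hfix _ (not_le.1 hc)
    rw [Equiv.apply_symm_apply] at this
    exact hc (this ▸ hs)
  have hr : p < ρ p := lt_of_le_of_ne (hge p le_rfl) (Ne.symm hp)
  have hq : p < ρ.symm p := by
    refine lt_of_le_of_ne (hge' p le_rfl) fun hc => hp ?_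
    rw [Equiv.eq_symm_apply] at hc
    exact hc
  have hind : ∀ s, p ≤ s → s < ρ.symm p → Indep c r (f s) (f (ρ.symm p)) := by
    intro s hs hs'
    by_contra hc
    have h1 := (hd _ _ hc).1 hs'
    rw [Equiv.apply_symm_apply] at h1
    exact absurd (hge s hs) (not_le.2 h1)
  have hind' : ∀ s, p ≤ s → s < ρ p → Indep c r (f' s) (f' (ρ p)) := by
    intro s hs hs'
    rw [hρ, ← ρ.apply_symm_apply s, hρ]
    by_contra hc
    have h1 := (hd _ _ hc).2 (by simpa using hs')
    exact absurd (hge' s hs) (not_le.2 h1)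
  have hq' : f (ρ.symm p) = f' p := by rw [← hρ, Equiv.apply_symm_apply]
  rcases lt_trichotomy (f (ρ.symm p)) (f p) with hlt | heq | hgt
  · exact hf _ _ hq hlt hind
  · exact not_indep_self _ (heq ▸ hind p le_rfl hq)
  · exact hf' p (ρ p) hr (by rwa [hρ, ← hq']) hind'

theorem isNormal_draws_unique {σ : Equiv.Perm (Fin n)} {g : Fin n → A} {e e' : Equiv.Perm (Fin n)}
    (h : Draws c r σ g (time ∘ e)) (h' : Draws c r σ g (time ∘ e'))
    (hn : IsNormal c r (g ∘ e.symm)) (hn' : IsNormal c r (g ∘ e'.symm)) : e = e' := by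
  have := eq_one_of_isNormal hn hn' (e.symm.trans e') (fun p => by simp) (fun p q hpq => by
    have := h.lt_iff h' hpq
    simpa [time_lt_time] using this)
  ext i
  simpa using (congr_arg Fin.val (Equiv.congr_fun this (e i))).symm

/-- `Fin.cycleIcc p q` moves `q` down to `p` and shifts `p, …, q - 1` up by one. -/
theorem val_cycleIcc {p q : Fin n} (hpq : p < q) (s : Fin n) :
    (Fin.cycleIcc p q s : ℕ) =
      if s = q then (p : ℕ) else if p ≤ s ∧ s < q then (s : ℕ) + 1 else s := by
  have : NeZero n := ⟨by have := p.2; omega⟩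
  rcases lt_or_ge s p with h | h
  · rw [Fin.cycleIcc_of_lt h, if_neg (h.trans hpq).ne, if_neg fun hc => absurd hc.1 (not_le.2 h)]
  rcases lt_or_ge q s with h' | h'
  · rw [Fin.cycleIcc_of_gt h', if_neg h'.ne', if_neg fun hc => absurd hc.2 (not_lt.2 h'.le)]
  · rw [Fin.cycleIcc_of_le_of_le h h']
    split_ifs with h1 h2
    · rfl
    · rw [Fin.val_add_one_of_lt' (by have := q.2; have := h2.2; omega)]
    · exact absurd ⟨h, lt_of_le_of_ne h' h1⟩ h2

theorem exists_isNormal_draws [Finite A] {σ : Equiv.Perm (Fin n)} {g : Fin n → A}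
    (h : IsGridding c r σ g) :
    ∃ e : Equiv.Perm (Fin n), Draws c r σ g (time ∘ e) ∧ IsNormal c r (g ∘ e.symm) := by
  obtain ⟨e, he, hmin⟩ := Set.exists_min_image {e : Equiv.Perm (Fin n) | Draws c r σ g (time ∘ e)}
    (fun e => toLex (g ∘ e.symm)) (Set.toFinite _) h.exists_draws_time
  refine ⟨e, he, fun p q hpq hlt hind => ?_⟩
  -- Moving the letter at `q` to position `p` gives a smaller word.
  have hval := val_cycleIcc hpq
  refine absurd (hmin (e.trans (Fin.cycleIcc p q)) (he.of_lt_iff fun i j hij => ?_)) (not_le.2 ?_)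
  · have h1 : ∀ k, p ≤ k → k < q → (e i = k → e j ≠ q) ∧ (e j = k → e i ≠ q) := by
      intro k hk hk'
      have := hind k hk hk'
      refine ⟨fun h2 h3 => hij ?_, fun h2 h3 => hij ?_⟩
      · simpa only [← h2, ← h3, Function.comp_apply, Equiv.symm_apply_apply] using this
      · simpa only [← h2, ← h3, Function.comp_apply, Equiv.symm_apply_apply] using this.symm
    have hi := fun h2 h3 => (h1 (e i) h2 h3).1 rfl
    have hj := fun h2 h3 => (h1 (e j) h2 h3).2 rfl
    simp only [Function.comp_apply, time_lt_time, Equiv.trans_apply, Fin.lt_def, hval]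
    simp only [ne_eq, Fin.lt_def, Fin.le_def, Fin.ext_iff] at hi hj hpq ⊢
    split_ifs <;> omega
  · refine ⟨p, fun s hs => ?_, ?_⟩
    · have : (Fin.cycleIcc p q).symm s = s := by
        rw [Equiv.symm_apply_eq, Fin.cycleIcc_of_lt hs]
      simp [this]
    · have : (Fin.cycleIcc p q).symm p = q := by
        rw [Equiv.symm_apply_eq, Fin.ext_iff, hval, if_pos rfl]
      simpa [this] using hlt

end NormalForm

end Words

/-! ### A regular set of unique codes -/

section Codes

variable {A B D : Type*} {c r : A → ℕ} {n : ℕ}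

theorem Draws.comp {m n : ℕ} {σ : Equiv.Perm (Fin m)} {π : Equiv.Perm (Fin n)} {g : Fin n → A}
    {τ : Fin n → ℝ} (h : Draws c r π g τ) {u : Fin m → Fin n} (hu : StrictMono u)
    (hσ : ∀ i j, σ i < σ j ↔ π (u i) < π (u j)) : Draws c r σ (g ∘ u) (τ ∘ u) where
  x i j := hu.lt_iff_lt.symm.trans (h.x (u i) (u j))
  y i j := (hσ i j).trans (h.y (u i) (u j))

/-- A property of permutations with marked entries is hereditary if it passes to subsequences. -/
def IsHereditary (Q : ∀ n, Equiv.Perm (Fin n) → (Fin n → B) → Prop) : Prop :=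
  ∀ m n (σ : Equiv.Perm (Fin m)) (π : Equiv.Perm (Fin n)) (u : Fin m → Fin n) (T : Fin n → B),
    StrictMono u → (∀ i j, σ i < σ j ↔ π (u i) < π (u j)) → Q n π T → Q m σ (T ∘ u)

variable (c r) in
/-- The property `Q` of permutations with marked entries is recognized by finite automata reading
the words that encode these permutations. The marks include the letters, by means of `p`. -/
def Recognizable (p : B → A) (Q : ∀ n, Equiv.Perm (Fin n) → (Fin n → B) → Prop) : Prop :=
  RegularPred fun n (f : Fin n → B) =>
    Q n (permOf c r (p ∘ f)) (f ∘ leftToRight c (p ∘ f))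

namespace Recognizable

variable {p : B → A} {Q R : ∀ n, Equiv.Perm (Fin n) → (Fin n → B) → Prop}

theorem of_isHereditary [Finite B] (hQ : IsHereditary Q) : Recognizable c r p Q := by
  refine RegularPred.of_hereditary fun m n u f hu h => ?_
  have hlt : ∀ i, (leftToRight c (p ∘ f)) ((leftToRight c (p ∘ f)).symm
      (u (leftToRight c (p ∘ f ∘ u) i))) = u (leftToRight c (p ∘ f ∘ u) i) :=
    fun i => Equiv.apply_symm_apply _ _
  convert hQ m n (permOf c r (p ∘ f ∘ u)) (permOf c r (p ∘ f))
    (fun i => (leftToRight c (p ∘ f)).symm (u (leftToRight c (p ∘ f ∘ u) i))) _ ?_ ?_ h using 1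
  · funext i
    simp [hlt]
  · intro i j hij
    rw [← leftToRight_lt_iff c (p ∘ f), hlt, hlt, ← key_time_comp_lt c (p ∘ f) hu]
    exact (leftToRight_lt_iff c _).2 hij
  · intro i j
    rw [permOf_lt_iff, permOf_lt_iff, hlt, hlt, ← key_time_comp_lt r (p ∘ f) hu]
    rfl

theorem and (hQ : Recognizable c r p Q) (hR : Recognizable c r p R) :
    Recognizable c r p fun n σ T => Q n σ T ∧ R n σ T :=
  RegularPred.and hQ hR

theorem not (hQ : Recognizable c r p Q) : Recognizable c r p fun n σ T => ¬ Q n σ T :=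
  RegularPred.not hQ

theorem congr (hQ : Recognizable c r p Q) (h : ∀ n σ T, Q n σ T ↔ R n σ T) :
    Recognizable c r p R :=
  RegularPred.congr hQ fun _ _ => h _ _ _

theorem exists_mark [Finite B] (P : B → Prop) :
    Recognizable c r p fun _ _ T => ∃ i, P (T i) :=
  (of_isHereditary (Q := fun _ _ T => ∀ i, ¬ P (T i))
    fun _ _ _ _ u _ _ _ h i => h (u i)).not.congr fun n σ T => by simp

theorem exists_marks {Q : ∀ n, Equiv.Perm (Fin n) → (Fin n → A × D) → Prop}
    (hQ : Recognizable c r Prod.fst Q) :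
    Recognizable c r id fun n σ f => ∃ T : Fin n → D, Q n σ fun i => (f i, T i) := by
  refine (RegularPred.exists_marks hQ).congr fun n f => ?_
  constructor
  · rintro ⟨m, hm⟩
    exact ⟨m ∘ leftToRight c f, hm⟩
  · rintro ⟨T, hT⟩
    refine ⟨T ∘ (leftToRight c f).symm, ?_⟩
    convert hT using 1
    · rfl
    funext i
    exact Prod.ext rfl (congr_arg T ((leftToRight c f).symm_apply_apply i))

end Recognizable

theorem pred_ofFn (P : ∀ n, (Fin n → A) → Prop) (f : Fin n → A) :
    P (List.ofFn f).length (List.ofFn f).get ↔ P n f := by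
  have h := List.equivSigmaTuple.apply_symm_apply (⟨n, f⟩ : Σ n, Fin n → A)
  exact iff_of_eq (congr_arg (fun s : Σ n, Fin n → A => P s.1 s.2) h)

variable [LinearOrder A]

variable (c r) in
/-- The gridding given by the word `f` is lexicographically least among all griddings of the
permutation drawn by `f`. -/
def IsPreferred {n : ℕ} (f : Fin n → A) : Prop :=
  ∀ g, IsGridding c r (permOf c r f) g → toLex (f ∘ leftToRight c f) ≤ toLex g

theorem regularPred_isPreferred [Finite A] : RegularPred fun _ (f : Fin _ → A) =>
    IsPreferred c r f := by
  -- A smaller gridding, with a mark at the first difference, is a hereditary marking.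
  have h1 : Recognizable c r Prod.fst fun n σ (T : Fin n → A × A × Bool) =>
      IsGridding c r σ (fun i => (T i).2.1) ∧ ∀ i, (T i).2.2 = true →
        (T i).2.1 < (T i).1 ∧ ∀ j, j < i → (T j).2.1 = (T j).1 := by
    refine Recognizable.of_isHereditary ?_
    rintro m n σ π u T hu hσ ⟨⟨τ, hτ⟩, h⟩
    exact ⟨⟨τ ∘ u, hτ.comp hu hσ⟩,
      fun i hi => ⟨(h (u i) hi).1, fun j hj => (h (u i) hi).2 (u j) (hu hj)⟩⟩
  refine RegularPred.congr (h1.and (.exists_mark fun b => b.2.2 = true)).exists_marks.not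
    fun n f => ?_
  rw [Function.id_comp]
  unfold IsPreferred
  rw [not_iff_comm]
  push Not
  constructor
  · rintro ⟨g, hg, i, hlt, hi⟩
    refine ⟨fun j => (g j, decide (j = i)), ⟨hg, ?_⟩, i, by simp⟩
    intro j hj
    obtain rfl : j = i := by simpa using hj
    exact ⟨hi, hlt⟩
  · rintro ⟨T, ⟨hg, hT⟩, i, hi⟩
    exact ⟨_, hg, i, (hT i hi).2, (hT i hi).1⟩

theorem regularPred_isNormal [Finite A] : RegularPred fun _ (f : Fin _ → A) =>
    IsNormal c r f := by
  -- The marks `0` and `1` flag the replaced letter and the letter to be moved.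
  have h1 : RegularPred fun n (f : Fin n → A × Fin 3) =>
      ∀ p q, (f p).2 = 0 → (f q).2 = 1 → p < q ∧ (f q).1 < (f p).1 ∧
        ∀ s, p ≤ s → s < q → Indep c r (f s).1 (f q).1 := by
    refine RegularPred.of_hereditary fun m n u f hu h p q hp hq => ?_
    obtain ⟨h2, h3, h4⟩ := h (u p) (u q) hp hq
    exact ⟨hu.lt_iff_lt.1 h2, h3, fun s hs hs' => h4 (u s) (hu.monotone hs) (hu hs')⟩
  refine ((h1.and (.exists_letter fun b => b.2 = 0)).and
    (.exists_letter fun b => b.2 = 1)).exists_marks.not.congr fun n f => ?_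
  rw [not_iff_comm]
  unfold IsNormal
  push Not
  constructor
  · rintro ⟨p, q, hpq, hlt, hind⟩
    refine ⟨fun i => if i = p then 0 else if i = q then 1 else 2, ⟨?_, p, by simp⟩, q,
      by simp [hpq.ne']⟩
    intro p' q' hp' hq'
    obtain rfl : p' = p := by
      by_contra hc
      simp only [hc, if_false] at hp'
      split_ifs at hp'
      all_goals simp_all
    obtain rfl : q' = q := by
      by_contra hc
      simp only [hc, if_false] at hq'
      split_ifs at hq'
      all_goals simp_all
    exact ⟨hpq, hlt, hind⟩
  · rintro ⟨m, ⟨h, p, hp⟩, q, hq⟩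
    obtain ⟨h2, h3, h4⟩ := h p q hp hq
    exact ⟨p, q, h2, h3, h4⟩

theorem eq_of_permOf_eq {f f' : Fin n → A} (h : permOf c r f = permOf c r f')
    (hp : IsPreferred c r f) (hn : IsNormal c r f) (hp' : IsPreferred c r f')
    (hn' : IsNormal c r f') : f = f' := by
  have hd := draws_permOf (c := c) (r := r) f
  have hd' := draws_permOf (c := c) (r := r) f'
  have hg : f ∘ leftToRight c f = f' ∘ leftToRight c f' :=
    toLex.injective (le_antisymm (hp _ ⟨_, h ▸ hd'⟩) (hp' _ ⟨_, h ▸ hd⟩))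
  have hcancel : ∀ f : Fin n → A, (f ∘ leftToRight c f) ∘ (leftToRight c f).symm = f := by
    intro f
    rw [Function.comp_assoc, Equiv.self_comp_symm, Function.comp_id]
  rw [← hg, ← h] at hd'
  have he := isNormal_draws_unique hd hd' (by rwa [hcancel]) (by rwa [hg, hcancel])
  rw [← hcancel f, hg, he, hcancel]

theorem exists_isPreferred_isNormal [Finite A] (f₀ : Fin n → A) :
    ∃ f : Fin n → A, permOf c r f = permOf c r f₀ ∧ IsPreferred c r f ∧ IsNormal c r f := by
  obtain ⟨g, hg, hmin⟩ := Set.exists_min_image {g | IsGridding c r (permOf c r f₀) g}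
    toLex (Set.toFinite _) ⟨_, _, draws_permOf f₀⟩
  obtain ⟨e, he, hn⟩ := exists_isNormal_draws hg
  have hge : (g ∘ e.symm) ∘ e = g := by
    rw [Function.comp_assoc, Equiv.symm_comp_self, Function.comp_id]
  have he' : Draws c r (permOf c r f₀) ((g ∘ e.symm) ∘ e) (time ∘ e) := by rwa [hge]
  refine ⟨g ∘ e.symm, he'.permOf_eq, ?_, hn⟩
  unfold IsPreferred
  rw [he'.permOf_eq, he'.leftToRight_eq, hge]
  exact hmin

/-- Each permutation drawn by a word has exactly one word which is a normal form and gives the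
preferred gridding. -/
theorem inBijectionWithRegularLanguage_of_recognizable {A : Type} [Fintype A] [LinearOrder A]
    (c r : A → ℕ) {S : Set Permutation}
    (hS : ∀ π ∈ S, ∃ f : Fin π.1 → A, permOf c r f = π.2)
    (hreg : Recognizable c r id fun n σ (_ : Fin n → A) => (⟨n, σ⟩ : Permutation) ∈ S) :
    InBijectionWithRegularLanguage S := by
  refine ⟨A, inferInstance, {w | (((⟨_, permOf c r w.get⟩ : Permutation) ∈ S ∧
    IsPreferred c r w.get) ∧ IsNormal c r w.get)},
    RegularPred.and (RegularPred.and hreg regularPred_isPreferred) regularPred_isNormal,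
    fun w => ⟨w.length, permOf c r w.get⟩, ⟨fun w hw => hw.1.1, ?_, ?_⟩, fun _ _ => rfl⟩
  · rintro w ⟨⟨-, hp⟩, hn⟩ w' ⟨⟨-, hp'⟩, hn'⟩ h
    have key : ∀ m n (f : Fin m → A) (f' : Fin n → A),
        (⟨m, permOf c r f⟩ : Permutation) = ⟨n, permOf c r f'⟩ → IsPreferred c r f →
        IsNormal c r f → IsPreferred c r f' → IsNormal c r f' → List.ofFn f = List.ofFn f' := by
      intro m n f f' h hp hn hp' hn'
      obtain ⟨rfl, h⟩ := Sigma.mk.inj_iff.1 h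
      rw [eq_of_permOf_eq (eq_of_heq h) hp hn hp' hn']
    simpa using key _ _ _ _ h hp hn hp' hn'
  · rintro ⟨n, σ⟩ hσ
    obtain ⟨f₀, hf₀⟩ := hS _ hσ
    obtain ⟨f, hf, hp, hn⟩ := exists_isPreferred_isNormal (c := c) (r := r) f₀
    have hf : permOf c r f = σ := hf.trans hf₀
    have h := (pred_ofFn (fun n f => (⟨n, permOf c r f⟩ : Permutation) = ⟨_, σ⟩) f).2 (by rw [hf])
    refine ⟨List.ofFn f, ⟨⟨?_, ?_⟩, ?_⟩, h⟩
    · rw [h]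
      exact hσ
    · exact (pred_ofFn (fun _ f => IsPreferred c r f) f).2 hp
    · exact (pred_ofFn (fun _ f => IsNormal c r f) f).2 hn

end Codes

/-! ### Geometric grid classes are drawn by words -/

section Geometry

variable {A ι : Type*}

/-- In the middle of slab number `K` of the figure, the two half slabs `2 * K` and `2 * K + 1`
meet; a point at distance `τ i` from the middle counts as inserted at time `τ i`. A point in the
middle itself may be assigned to either half, since no other point has its coordinate. -/
theorem lt_iff_key_lt {h : A → ℕ} {g : ι → A} {τ X : ι → ℝ} {K : ι → ℕ} {b : ι → Bool}
    (hX : Function.Injective X) (hh : ∀ i, h (g i) = 2 * K i + (b i).toNat)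
    (hτ : ∀ i, 0 ≤ τ i ∧ τ i < 1 / 2)
    (hXτ : ∀ i, X i = K i + 1 / 2 + if b i then τ i else -τ i) (i j : ι) :
    X i < X j ↔ key h g τ i < key h g τ j := by
  have main : ∀ i j, X i < X j → key h g τ i < key h g τ j := by
    intro i j hij
    have hi := hτ i
    have hj := hτ j
    rw [hXτ i, hXτ j] at hij
    have hK : K i < K j + 1 := by
      have : (K i : ℝ) < K j + 1 := by split_ifs at hij <;> linarith
      exact_mod_cast this
    rw [key_lt_key, hh, hh]
    rcases Nat.lt_succ_iff_lt_or_eq.1 hK with hK | hK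
    · left
      have := Bool.toNat_le (b i)
      omega
    · rw [hK] at hij ⊢
      cases hbi : b i <;> cases hbj : b j <;> simp [hbi, hbj] at hij ⊢
      · linarith
      · linarith
      · simpa [Nat.even_add_one] using hij
  refine ⟨main i j, fun hij => ?_⟩
  refine lt_of_le_of_ne (not_lt.1 fun hc => lt_asymm hij (main _ _ hc)) fun hc => ?_
  exact lt_irrefl _ (hX hc ▸ hij)

variable {t u : ℕ}

/-- The column of a half cell `(k, l, b)`: cell `(k, l)` of a matrix is cut by the vertical line
through its centre into a left (`b = false`) and a right (`b = true`) half. -/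
def halfCol (a : Fin t ×ₗ Fin u ×ₗ Bool) : ℕ :=
  2 * ((ofLex a).1 : ℕ) + (ofLex (ofLex a).2).2.toNat

/-- The row of a half cell: the right half of the segment in a cell is its upper half if the
segment increases, and its lower half otherwise. Empty cells of the matrix are treated like those
with a decreasing segment; no points lie in them. -/
def halfRow (M : Matrix (Fin t) (Fin u) SignType) (a : Fin t ×ₗ Fin u ×ₗ Bool) : ℕ :=
  2 * ((ofLex (ofLex a).2).1 : ℕ) +
    (if M (ofLex a).1 (ofLex (ofLex a).2).1 = 1 then (ofLex (ofLex a).2).2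
      else !(ofLex (ofLex a).2).2).toNat

theorem exists_halfCell {M : Matrix (Fin t) (Fin u) SignType} {p : ℝ × ℝ}
    (hp : p ∈ standardFigure M) : ∃ (k : Fin t) (l : Fin u) (b : Bool) (d : ℝ),
      (0 ≤ d ∧ d < 1 / 2) ∧ p.1 = (k : ℕ) + 1 / 2 + (if b then d else -d) ∧
      p.2 = (l : ℕ) + 1 / 2 + (if (if M k l = 1 then b else !b) then d else -d) := by
  obtain ⟨k, l, ⟨hM, v, w, hv, hw, hvw, rfl⟩ | ⟨hM, v, w, hv, hw, hvw, rfl⟩⟩ := hp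
  all_goals
    obtain rfl : v = 1 - w := by linarith
    refine ⟨k, l, decide (1 / 2 < w), |w - 1 / 2|, ⟨abs_nonneg _, ?_⟩, ?_, ?_⟩
    · rw [abs_lt]
      constructor <;> linarith
    all_goals
      rcases lt_or_ge (1 / 2) w with h | h
      · simp only [h, hM, decide_true, if_true, abs_of_pos (sub_pos.2 h)]
        simp
        try ring
      · simp only [not_lt.2 h, hM, decide_false, abs_of_nonpos (sub_nonpos.2 h)]
        simp
        try ring

theorem exists_permOf_eq_of_mem_geom (M : Matrix (Fin t) (Fin u) SignType) {π : Permutation}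
    (hπ : π ∈ Geom M) : ∃ f : Fin π.1 → Fin t ×ₗ Fin u ×ₗ Bool,
      permOf halfCol (halfRow M) f = π.2 := by
  obtain ⟨p, hpM, hpx, hpy⟩ := hπ
  choose k l b d hd hx hy using fun i => exists_halfCell (hpM i)
  refine exists_permOf_eq_of_isGridding (g := fun i => toLex (k i, toLex (l i, b i)))
    ⟨d, fun i j => ?_, fun i j => ?_⟩
  · rw [← hpx.lt_iff_lt]
    exact lt_iff_key_lt (X := fun i => (p i).1) (K := fun i => k i) (b := b)
      hpx.injective (fun i => rfl) hd hx i j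
  · rw [hpy]
    refine lt_iff_key_lt (X := fun i => (p i).2) (K := fun i => l i)
      (b := fun i => if M (k i) (l i) = 1 then b i else !b i) (fun i j hij => ?_) (fun i => rfl)
      hd hy i j
    by_contra hne
    rcases lt_or_gt_of_ne (π.2.injective.ne hne) with hlt | hlt
    · exact ((hpy _ _).1 hlt).ne hij
    · exact ((hpy _ _).1 hlt).ne' hij

end Geometry

/-! ### Simple and indecomposable permutations -/

/-- A nontrivial interval, as the set of entries marked `true`. -/
theorem not_isSimple_iff {π : Permutation} (hπ : 2 ≤ π.length) :
    ¬ IsSimple π ↔ ∃ T : Fin π.1 → Bool,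
      ((∀ i j k, T i = true → T k = true → T j = false →
          ¬ (i < j ∧ j < k) ∧ ¬ (π.2 i < π.2 j ∧ π.2 j < π.2 k)) ∧
        ¬ ∀ i j, T i = true → T j = true → i = j) ∧ ∃ j, T j = false := by
  classical
  unfold IsSimple
  rw [not_and]
  simp only [hπ, true_imp_iff, not_forall, not_or, exists_prop]
  constructor
  · rintro ⟨I, ⟨hI, hI'⟩, h0, h1, hn⟩
    refine ⟨fun i => decide (i ∈ I), ⟨fun i j k hi hk hj => ?_, ?_⟩, ?_⟩
    · simp only [decide_eq_true_eq, decide_eq_false_iff_not] at hi hj hk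
      constructor
      · rintro ⟨hij, hjk⟩
        exact hj (hI.out hi hk ⟨hij.le, hjk.le⟩)
      · rintro ⟨hij, hjk⟩
        have := hI'.out (Set.mem_image_of_mem _ hi) (Set.mem_image_of_mem _ hk)
          ⟨hij.le, hjk.le⟩
        exact hj ((π.2.injective.mem_set_image).1 this)
    · have h2 : 1 < I.ncard := by omega
      obtain ⟨i, hi, j, hj, hij⟩ := (Set.one_lt_ncard (Set.toFinite _)).1 h2
      exact ⟨i, j, by simpa, by simpa, hij⟩
    · by_contra! hc
      have : I = Set.univ := Set.eq_univ_of_forall fun i => by simpa using hc i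
      exact hn (by rw [this, Set.ncard_univ, Nat.card_fin])
  · rintro ⟨T, ⟨hT, i, j, hi, hj, hij⟩, x, hx⟩
    refine ⟨{i | T i = true}, ⟨⟨?_⟩, ⟨?_⟩⟩, ?_⟩
    · intro i hi k hk j hj
      by_contra hc
      have hj' : T j = false := by simpa using hc
      have hij : i ≠ j := by
        rintro rfl
        exact hc hi
      have hjk : j ≠ k := by
        rintro rfl
        exact hc hk
      exact (hT i j k hi hk hj').1 ⟨lt_of_le_of_ne hj.1 hij, lt_of_le_of_ne hj.2 hjk⟩
    · rintro _ ⟨i, hi, rfl⟩ _ ⟨k, hk, rfl⟩ y hj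
      obtain ⟨j, rfl⟩ := π.2.surjective y
      by_contra hc
      rw [π.2.injective.mem_set_image] at hc
      have hj' : T j = false := by simpa using hc
      have hij : π.2 i ≠ π.2 j := fun he => hc (π.2.injective he ▸ hi)
      have hjk : π.2 j ≠ π.2 k := fun he => hc (π.2.injective he ▸ hk)
      exact (hT i j k hi hk hj').2 ⟨lt_of_le_of_ne hj.1 hij, lt_of_le_of_ne hj.2 hjk⟩
    · have h2 : 1 < {i | T i = true}.ncard :=
        (Set.one_lt_ncard (Set.toFinite _)).2 ⟨i, hi, j, hj, hij⟩
      have h3 : {i | T i = true}.ncard < π.1 := by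
        have := Set.ncard_lt_card (s := {i | T i = true}) (fun hc => by
          have := Set.eq_univ_iff_forall.1 hc x
          simp [hx] at this)
        simpa using this
      exact ⟨by omega, by omega, h3.ne⟩

theorem directSum_castAdd {a b : ℕ} (σ : Equiv.Perm (Fin a)) (τ : Equiv.Perm (Fin b))
    (i : Fin a) : (directSum ⟨a, σ⟩ ⟨b, τ⟩).2 (Fin.castAdd b i) = Fin.castAdd b (σ i) :=
  congr_arg (fun s => finSumFinEquiv (Equiv.sumCongr σ τ s)) (finSumFinEquiv_symm_apply_castAdd i)

theorem directSum_natAdd {a b : ℕ} (σ : Equiv.Perm (Fin a)) (τ : Equiv.Perm (Fin b))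
    (i : Fin b) : (directSum ⟨a, σ⟩ ⟨b, τ⟩).2 (Fin.natAdd a i) = Fin.natAdd a (τ i) :=
  congr_arg (fun s => finSumFinEquiv (Equiv.sumCongr σ τ s)) (finSumFinEquiv_symm_apply_natAdd i)

/-- A splitting into a sum, with the entries of the second summand marked `true`. -/
def SumSplits {n : ℕ} (σ : Equiv.Perm (Fin n)) : Prop :=
  ∃ T : Fin n → Bool,
    ((∀ i j, T i = false → T j = true → i < j ∧ σ i < σ j) ∧ ∃ i, T i = false) ∧ ∃ j, T j = true

theorem exists_eq_directSum {a b : ℕ} (π : Equiv.Perm (Fin (a + b)))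
    (h : ∀ (i : Fin a) (j : Fin b), π (Fin.castAdd b i) < π (Fin.natAdd a j)) :
    ∃ (σ : Equiv.Perm (Fin a)) (τ : Equiv.Perm (Fin b)),
      (⟨a + b, π⟩ : Permutation) = directSum ⟨a, σ⟩ ⟨b, τ⟩ := by
  have hlt : ∀ i : Fin a, (π (Fin.castAdd b i) : ℕ) < a := by
    intro i
    have h1 := Finset.card_le_card_of_injOn (s := (Finset.univ : Finset (Fin b)))
      (t := Finset.Ioi (π (Fin.castAdd b i))) (fun j => π (Fin.natAdd a j))
      (fun j _ => by simpa using h i j)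
      (fun j _ k _ hjk => by simpa using π.injective hjk)
    rw [Finset.card_univ, Fintype.card_fin, Fin.card_Ioi] at h1
    have := (π (Fin.castAdd b i)).2
    have := i.2
    omega
  let ρ : Equiv.Perm (Fin a ⊕ Fin b) := finSumFinEquiv.trans (π.trans finSumFinEquiv.symm)
  have hmaps : Set.MapsTo ρ (Set.range Sum.inl) (Set.range Sum.inl) := by
    rintro _ ⟨i, rfl⟩
    refine ⟨⟨_, hlt i⟩, ?_⟩
    rw [← Equiv.apply_eq_iff_eq finSumFinEquiv]
    simp only [ρ, Equiv.trans_apply, Equiv.apply_symm_apply, finSumFinEquiv_apply_left]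
    rfl
  obtain ⟨⟨σ, τ⟩, hρ⟩ := Equiv.Perm.mem_sumCongrHom_range_of_perm_mapsTo_inl hmaps
  refine ⟨σ, τ, ?_⟩
  have hρ' : Equiv.sumCongr σ τ = ρ := hρ
  unfold directSum
  simp only [hρ']
  congr 1
  ext i
  simp [ρ]

theorem not_isSumIndecomposable_iff {π : Permutation} :
    ¬ IsSumIndecomposable π ↔ SumSplits π.2 := by
  classical
  unfold IsSumIndecomposable
  rw [not_not]
  constructor
  · rintro ⟨⟨a, σ⟩, ⟨b, τ⟩, hσ, hτ, rfl⟩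
    have hσ : a < a + b := hσ
    have hτ : b < a + b := hτ
    have h1 := directSum_castAdd σ τ
    have h2 := directSum_natAdd σ τ
    generalize (directSum ⟨a, σ⟩ ⟨b, τ⟩).2 = π at h1 h2 ⊢
    change Equiv.Perm (Fin (a + b)) at π
    refine ⟨fun i : Fin (a + b) => decide (a ≤ (i : ℕ)),
      ⟨?_, ⟨(⟨0, by omega⟩ : Fin (a + b)), ?_⟩⟩, ⟨(⟨a, by omega⟩ : Fin (a + b)), ?_⟩⟩
    · intro (i : Fin (a + b)) (j : Fin (a + b)) hi hj
      simp only [decide_eq_true_eq, decide_eq_false_iff_not, not_le] at hi hj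
      obtain ⟨i, rfl⟩ : ∃ i', i = Fin.castAdd b i' := ⟨⟨i, hi⟩, rfl⟩
      obtain ⟨j, rfl⟩ : ∃ j', j = Fin.natAdd a j' :=
        ⟨⟨(j : ℕ) - a, by have : (j : ℕ) < a + b := j.2; omega⟩,
          Fin.ext (Nat.add_sub_cancel' hj).symm⟩
      have hlt : ∀ (i : Fin a) (j : Fin b), Fin.castAdd b i < Fin.natAdd a j := by
        intro i j
        rw [Fin.lt_def, Fin.val_castAdd, Fin.val_natAdd]
        omega
      refine ⟨hlt i j, ?_⟩
      rw [h1, h2]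
      exact hlt _ _
    · simp only [decide_eq_false_iff_not]
      omega
    · simp
  · obtain ⟨n, π⟩ := π
    rintro ⟨T, ⟨hT, i, hi⟩, j, hj⟩
    change Fin n → Bool at T
    change Fin n at i j
    -- the second summand starts at the first marked entry
    obtain ⟨⟨a, ha⟩, hj₀, hmin⟩ :=
      WellFounded.has_min (wellFounded_lt (α := Fin n)) {j | T j = true} ⟨j, hj⟩
    obtain ⟨b, rfl⟩ : ∃ b, n = a + b := ⟨n - a, by omega⟩
    have hlow : ∀ s : Fin (a + b), (s : ℕ) < a → T s = false := fun s hs => by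
      have := fun h => hmin s h hs
      simpa using this
    have hhigh : ∀ s : Fin (a + b), a ≤ (s : ℕ) → T s = true := fun s hs => by
      by_contra hc
      exact absurd (hT s _ (by simpa using hc) hj₀).1 (not_lt.2 hs)
    obtain ⟨σ, τ, h⟩ := exists_eq_directSum (a := a) (b := b) π fun s s' =>
      (hT _ _ (hlow _ (by simp)) (hhigh _ (by simp))).2
    have h1 : (i : ℕ) < a := (hT i _ hi hj₀).1
    refine ⟨_, _, ?_, ?_, h⟩
    · exact ha
    · change b < a + b
      omega

/-- The vertical mirror image of a permutation. -/
def complement (π : Permutation) : Permutation := ⟨π.1, π.2.trans Fin.revPerm⟩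

theorem complement_complement (π : Permutation) : complement (complement π) = π := by
  obtain ⟨n, π⟩ := π
  unfold complement
  congr 1
  ext i
  simp

theorem complement_skewSum (σ τ : Permutation) :
    complement (skewSum σ τ) = directSum (complement σ) (complement τ) := by
  obtain ⟨m, σ⟩ := σ
  obtain ⟨n, τ⟩ := τ
  unfold complement skewSum directSum
  congr 1
  ext i
  refine Fin.addCases (fun i => ?_) (fun i => ?_) i
  · simp [Fin.val_rev]
    omega
  · simp [Fin.val_rev]
    omega

theorem isSkewIndecomposable_iff {π : Permutation} :
    IsSkewIndecomposable π ↔ IsSumIndecomposable (complement π) := by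
  unfold IsSkewIndecomposable IsSumIndecomposable
  rw [not_iff_not]
  constructor
  · rintro ⟨σ, τ, hσ, hτ, rfl⟩
    exact ⟨complement σ, complement τ, hσ, hτ, complement_skewSum σ τ⟩
  · rintro ⟨σ, τ, hσ, hτ, h⟩
    refine ⟨complement σ, complement τ, hσ, hτ, ?_⟩
    rw [← complement_complement π, h, ← complement_complement (skewSum _ _), complement_skewSum,
      complement_complement, complement_complement]

theorem not_isSkewIndecomposable_iff {π : Permutation} :
    ¬ IsSkewIndecomposable π ↔ ∃ T : Fin π.1 → Bool,
      ((∀ i j, T i = false → T j = true → i < j ∧ π.2 j < π.2 i) ∧ ∃ i, T i = false) ∧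
        ∃ j, T j = true := by
  rw [isSkewIndecomposable_iff, not_isSumIndecomposable_iff]
  refine exists_congr fun T => and_congr (and_congr (forall₂_congr fun i j => imp_congr Iff.rfl
    (imp_congr Iff.rfl (and_congr Iff.rfl ?_))) Iff.rfl) Iff.rfl
  exact Fin.rev_lt_rev

section Recognize

variable {A : Type*} [Finite A] (c r : A → ℕ)

theorem recognizable_isSimple :
    Recognizable c r id fun n σ (_ : Fin n → A) => IsSimple ⟨n, σ⟩ := by
  have h1 : Recognizable c r Prod.fst fun n σ (T : Fin n → A × Bool) =>
      ∀ i j k, (T i).2 = true → (T k).2 = true → (T j).2 = false →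
        ¬ (i < j ∧ j < k) ∧ ¬ (σ i < σ j ∧ σ j < σ k) := by
    refine .of_isHereditary fun m n σ π u T hu hσ h i j k hi hk hj => ?_
    rw [hσ, hσ, ← hu.lt_iff_lt, ← hu.lt_iff_lt (a := j)]
    exact h (u i) (u j) (u k) hi hk hj
  have h2 : Recognizable c r Prod.fst fun n σ (T : Fin n → A × Bool) =>
      ∀ i j, (T i).2 = true → (T j).2 = true → i = j :=
    .of_isHereditary fun m n σ π u T hu hσ h i j hi hj => hu.injective (h _ _ hi hj)
  have h3 : Recognizable c r id fun n σ (_ : Fin n → A) => n < 2 :=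
    .of_isHereditary fun m n σ π u T hu hσ h =>
      lt_of_le_of_lt (by simpa using Fintype.card_le_of_injective u hu.injective) h
  refine (h3.not.and ((h1.and h2.not).and
    (.exists_mark fun b => b.2 = false)).exists_marks.not).congr fun n σ T => ?_
  rw [not_lt]
  by_cases hn : 2 ≤ n
  · have := not_isSimple_iff (π := ⟨n, σ⟩) hn
    simp only [hn, true_and]
    exact not_iff_comm.1 this
  · simp only [hn, false_and, false_iff]
    exact fun h => hn h.1

theorem recognizable_isSumIndecomposable :
    Recognizable c r id fun n σ (_ : Fin n → A) => IsSumIndecomposable ⟨n, σ⟩ := by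
  have h1 : Recognizable c r Prod.fst fun n σ (T : Fin n → A × Bool) =>
      ∀ i j, (T i).2 = false → (T j).2 = true → i < j ∧ σ i < σ j := by
    refine .of_isHereditary fun m n σ π u T hu hσ h i j hi hj => ?_
    rw [hσ, ← hu.lt_iff_lt]
    exact h (u i) (u j) hi hj
  refine ((h1.and (.exists_mark fun b => b.2 = false)).and
    (.exists_mark fun b => b.2 = true)).exists_marks.not.congr fun n σ T => ?_
  exact not_iff_comm.1 (not_isSumIndecomposable_iff (π := ⟨n, σ⟩))

theorem recognizable_isSkewIndecomposable :
    Recognizable c r id fun n σ (_ : Fin n → A) => IsSkewIndecomposable ⟨n, σ⟩ := by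
  have h1 : Recognizable c r Prod.fst fun n σ (T : Fin n → A × Bool) =>
      ∀ i j, (T i).2 = false → (T j).2 = true → i < j ∧ σ j < σ i := by
    refine .of_isHereditary fun m n σ π u T hu hσ h i j hi hj => ?_
    rw [hσ, ← hu.lt_iff_lt]
    exact h (u i) (u j) hi hj
  refine ((h1.and (.exists_mark fun b => b.2 = false)).and
    (.exists_mark fun b => b.2 = true)).exists_marks.not.congr fun n σ T => ?_
  exact not_iff_comm.1 (not_isSkewIndecomposable_iff (π := ⟨n, σ⟩))

theorem recognizable_mem {C : Set Permutation} (hC : IsPermutationClass C) :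
    Recognizable c r id fun n σ (_ : Fin n → A) => (⟨n, σ⟩ : Permutation) ∈ C :=
  .of_isHereditary fun _ _ _ _ u _ hu hσ h => hC _ h _ ⟨u, hu, hσ⟩

end Recognize

theorem IsGeometricallyGriddable.inBijectionWithRegularLanguage {C : Set Permutation}
    (hC : IsGeometricallyGriddable C) {P : Permutation → Prop}
    (hP : ∀ (A : Type) [Finite A] (c r : A → ℕ),
      Recognizable c r id fun n σ (_ : Fin n → A) => P ⟨n, σ⟩) :
    InBijectionWithRegularLanguage {π | π ∈ C ∧ P π} := by
  obtain ⟨hC, t, u, M, hM⟩ := hC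
  have : Fintype (Fin t ×ₗ Fin u ×ₗ Bool) := inferInstanceAs (Fintype (Fin t × Fin u × Bool))
  exact inBijectionWithRegularLanguage_of_recognizable halfCol (halfRow M)
    (fun π hπ => exists_permOf_eq_of_mem_geom M (hM hπ.1))
    ((recognizable_mem _ _ hC).and (hP _ _ _))

end GeomGrid

theorem mainTheorem4 (C : Set GeomGrid.Permutation) (hC : GeomGrid.IsGeometricallyGriddable C) :
    (GeomGrid.InBijectionWithRegularLanguage {π | π ∈ C ∧ GeomGrid.IsSimple π} ∧
      GeomGrid.InBijectionWithRegularLanguage {π | π ∈ C ∧ GeomGrid.IsSumIndecomposable π} ∧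
      GeomGrid.InBijectionWithRegularLanguage {π | π ∈ C ∧ GeomGrid.IsSkewIndecomposable π}) ∧
    (GeomGrid.IsRationalSeries
        (GeomGrid.generatingFunction {π | π ∈ C ∧ GeomGrid.IsSimple π}) ∧
      GeomGrid.IsRationalSeries
        (GeomGrid.generatingFunction {π | π ∈ C ∧ GeomGrid.IsSumIndecomposable π}) ∧
      GeomGrid.IsRationalSeries
        (GeomGrid.generatingFunction {π | π ∈ C ∧ GeomGrid.IsSkewIndecomposable π})) := by
  have h₁ := hC.inBijectionWithRegularLanguage fun _ _ c r => GeomGrid.recognizable_isSimple c r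
  have h₂ := hC.inBijectionWithRegularLanguage
    fun _ _ c r => GeomGrid.recognizable_isSumIndecomposable c r
  have h₃ := hC.inBijectionWithRegularLanguage
    fun _ _ c r => GeomGrid.recognizable_isSkewIndecomposable c r
  exact ⟨⟨h₁, h₂, h₃⟩, h₁.isRationalSeries, h₂.isRationalSeries, h₃.isRationalSeries⟩
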